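/- Let $L_a^2(\mathbb D)$ be the Bergman space of analytic functions $f$ on the open unit disk $\mathbb D$ with $\|f\|^2=\frac1\pi\int_{\mathbb D}|f|^2\,dA<\infty$ ($dA$ = area measure), let $P$ be the orthogonal projection of $L^2(\mathbb D,\frac1\pi dA)$ onto $L_a^2(\mathbb D)$, and let $X=T_{1-|z|^2}$ be the Toeplitz operator $Xf=P\big((1-|z|^2)f\big)$ on $L_a^2(\mathbb D)$. Conventions. An Orlicz function is a convex, nondecreasing, continuous function $\varphi:[0,\infty)\to[0,\infty]$ with $\varphi(0)=0$, $\varphi(t)>0$ for $t>0$, and $\varphi(t)\to\infty$ as $t\to\infty$. It satisfies $\varphi\in\delta_2(0)$ if there are $u_0>0$ and $k>2$ with $\varphi(2u)\le k\varphi(u)$ for $0\le u\le u_0$. For a compact operator $x$ on a complex Hilbert space let $s_0(x)\ge s_1(x)\ge\dots$ be its singular values, i.e. the eigenvalues of $|x|=(x^*x)^{1/2}$ in decreasing order, repeated according to multiplicity. Put $S_\varphi=\{x \text{ compact}:\ \sum_n\varphi(\lambda s_n(x))<\infty\text{ for some }\lambda>0\}$, with Luxemburg norm $\|x\|_\varphi=\inf\{\lambda>0:\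 \sum_n\varphi(s_n(x)/\lambda)\le1\}$, and $S_p=\{x\text{ compact}:\ \sum_n s_n(x)^p<\infty\}$ with $\|x\|_p=(\sum_n s_n(x)^p)^{1/p}$. Write $e\otimes h$ for the operator $\xi\mapsto\langle h,\xi\rangle e$, the inner product being linear in $\xi$. Then the following hold. 1. The functions $e_n(z)=\sqrt{n+1}\,z^n$, $n\ge0$, form an orthonormal basis of $L_a^2(\mathbb D)$. The operator $X$ is compact, self-adjoint and positive, $Xe_n=\frac1{n+2}e_n$ for all $n$, and $X=\sum_{n\ge0}\frac1{n+2}\,e_n\otimes e_n$ in operator norm. 2. There are Orlicz functions $\varphi$ with $\sum_{n\ge0}\varphi\big(\frac1{n+1}\big)<\infty$. For every such $\varphi$ one has $\varphi(X)=\sum_{n\ge0}\varphi\big(\frac1{n+2}\big)e_n\otimes e_n$ in operator norm (where $\varphi(X)$ is given by the continuous functional calculus), $\mathrm{Tr}(\varphi(X))=\sum_{n\ge0}\varphi(s_n(X))=\sum_{n\ge0}\varphi\big(\frac1{n+2}\big)<\infty$ (the trace being computed in any orthonormal basis), and $X\in S_\varphi$. 3. $X\notin S_1$, and $X\in S_p$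 for every real $p>1$. 4. If $\varphi$ is an Orlicz function with $\varphi\in\delta_2(0)$ and $X\in S_\varphi$, then $\|X\|_\varphi>0$ and $\sum_{n\ge0}\varphi\Big(\frac1{(n+2)\|X\|_\varphi}\Big)=1$. 5. For every real $p>1$ and $\varphi(t)=t^p$, one has $X\in S_\varphi$ and $$\|X\|_\varphi=\|X\|_p=\Big(\sum_{n\ge0}\frac1{(n+2)^p}\Big)^{1/p}=(\zeta(p)-1)^{1/p},$$ where $\zeta$ is the Riemann zeta function. -/

import Mathlib

open MeasureTheory Filter Topology
open scoped ENNReal NNReal InnerProductSpace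

/-- Orlicz functions `φ : [0,∞) → [0,∞]`. -/
structure IsOrliczFunction (φ : ℝ≥0 → ℝ≥0∞) : Prop where
  convex : ConvexOn ℝ≥0 Set.univ φ
  mono : Monotone φ
  cont : Continuous φ
  map_zero : φ 0 = 0
  pos : ∀ t, 0 < t → 0 < φ t
  tendsto_top : Tendsto φ atTop (𝓝 ∞)

/-- The condition `δ₂` near zero. -/
def DeltaTwoNearZero (φ : ℝ≥0 → ℝ≥0∞) : Prop :=
  ∃ u₀ k : ℝ≥0, 0 < u₀ ∧ 2 < k ∧ ∀ u ≤ u₀, φ (2 * u) ≤ k * φ u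

namespace HilbertOp

variable {H : Type*} [NormedAddCommGroup H] [InnerProductSpace ℂ H] [CompleteSpace H]

/-- The `n`-th singular value (`n = 0, 1, …`) of a compact operator `x`: the `n`-th eigenvalue of
`|x| = (x* x)^{1/2}`, the eigenvalues being listed in decreasing order and repeated according to
multiplicity (followed by zeros if only finitely many are nonzero). In other words, the least `t`
such that at most `n` eigenvalues of `|x|`, counted with multiplicity, exceed `t`. -/
noncomputable def singularValue (x : H →L[ℂ] H) (n : ℕ) : ℝ≥0 :=
  sInf {t : ℝ≥0 | Module.rank ℂ
    (⨆ μ : Set.Ioi t, Module.End.eigenspace ((CFC.abs x : H →L[ℂ] H) : Module.End ℂ H)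
      (((μ : ℝ≥0) : ℝ) : ℂ) : Submodule ℂ H) ≤ n}

/-- The Schatten class `S_p`. -/
def schattenClass (p : ℝ) : Set (H →L[ℂ] H) :=
  {x | IsCompactOperator x ∧ Summable fun n => (singularValue x n : ℝ) ^ p}

/-- The Schatten norm `‖x‖_p = (∑ s_n(x)^p)^{1/p}`. -/
noncomputable def schattenNorm (p : ℝ) (x : H →L[ℂ] H) : ℝ :=
  (∑' n, (singularValue x n : ℝ) ^ p) ^ (1 / p)

/-- The noncommutative Orlicz sequence space `S_φ`. -/
def orliczClass (φ : ℝ≥0 → ℝ≥0∞) : Set (H →L[ℂ] H) :=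
  {x | IsCompactOperator x ∧ ∃ c : ℝ≥0, 0 < c ∧ ∑' n, φ (c * singularValue x n) < ∞}

/-- The Luxemburg norm on `S_φ`. -/
noncomputable def luxemburgNorm (φ : ℝ≥0 → ℝ≥0∞) (x : H →L[ℂ] H) : ℝ≥0 :=
  sInf {c : ℝ≥0 | 0 < c ∧ ∑' n, φ (singularValue x n / c) ≤ 1}

/-- `φ(x)` for a positive operator `x` such that `φ` is finite on the spectrum of `x`, through the
continuous functional calculus. -/
noncomputable def apply (φ : ℝ≥0 → ℝ≥0∞) (x : H →L[ℂ] H) : H →L[ℂ] H :=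
  cfc (fun t : ℝ≥0 => (φ t).toNNReal) x

/-- `Tr(x) = τ`: the series `∑ ⟨e_k, x e_k⟩` converges unconditionally to `τ` for every orthonormal
basis `(e_k)` of `H`. -/
def HasTrace (x : H →L[ℂ] H) (τ : ℂ) : Prop :=
  ∀ (ι : Type) (e : HilbertBasis ι ℂ H), HasSum (fun k => ⟪e k, x (e k)⟫_ℂ) τ

end HilbertOp

namespace Bergman

/-- Normalised area measure `dA / π` on the open unit disk. -/
noncomputable def diskMeasure : Measure ℂ :=
  ENNReal.ofReal (Real.pi)⁻¹ • volume.restrict (Metric.ball (0 : ℂ) 1)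

theorem ae_iff_diskMeasure {p : ℂ → Prop} :
    (∀ᵐ z ∂diskMeasure, p z) ↔ ∀ᵐ z ∂volume.restrict (Metric.ball (0 : ℂ) 1), p z := by
  have h : ENNReal.ofReal (Real.pi)⁻¹ ≠ 0 := by
    simp [Real.pi_pos]
  rw [diskMeasure, Measure.ae_ennreal_smul_measure_iff h]

theorem circle_bound {g : ℂ → ℂ} (hg : DifferentiableOn ℂ g (Metric.ball 0 1)) {c : ℂ} {ρ : ℝ}
    (hρ : 0 ≤ ρ) (hc : Metric.closedBall c ρ ⊆ Metric.ball 0 1) :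
    ENNReal.ofReal (2 * Real.pi) * ‖g c‖ₑ ^ 2 ≤
      ∫⁻ θ in Set.Ioo (-Real.pi) Real.pi, ‖g (circleMap c ρ θ)‖ₑ ^ 2 := by
  have h1 : Real.circleAverage (fun z => g z ^ 2) c ρ = g c ^ 2 := by
    apply DiffContOnCl.circleAverage
    rw [abs_of_nonneg hρ]
    apply DifferentiableOn.diffContOnCl
    exact (hg.pow 2).mono (Metric.closure_ball_subset_closedBall.trans hc)
  have hpi := Real.pi_pos
  rw [Real.circleAverage_eq_integral_add (-Real.pi),
    intervalIntegral.integral_comp_add_right (fun θ => g (circleMap c ρ θ) ^ 2)] at h1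
  have h2 : ∫ θ in (0 + -Real.pi)..(2 * Real.pi + -Real.pi), g (circleMap c ρ θ) ^ 2
      = (2 * Real.pi : ℝ) • g c ^ 2 := by
    rw [← h1, smul_smul, mul_inv_cancel₀ (by positivity), one_smul]
  have e1 : (0 + -Real.pi) = -Real.pi := by ring
  have e2 : (2 * Real.pi + -Real.pi) = Real.pi := by ring
  rw [e1, e2, intervalIntegral.integral_of_le (by linarith), integral_Ioc_eq_integral_Ioo] at h2
  have h3 := enorm_integral_le_lintegral_enorm (μ := volume.restrict (Set.Ioo (-Real.pi) Real.pi))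
    (fun θ => g (circleMap c ρ θ) ^ 2)
  rw [h2, enorm_smul, enorm_pow] at h3
  simp only [enorm_pow] at h3
  rwa [Real.enorm_of_nonneg (by positivity)] at h3

theorem area_bound {g : ℂ → ℂ} (hg : DifferentiableOn ℂ g (Metric.ball 0 1)) {c : ℂ} {r : ℝ}
    (hr : 0 < r) (hc : Metric.closedBall c r ⊆ Metric.ball 0 1) :
    ENNReal.ofReal (Real.pi * r ^ 2 / 2) * ‖g c‖ₑ ^ 2 ≤
      ∫⁻ z in Metric.ball (0 : ℂ) 1, ‖g z‖ₑ ^ 2 := by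
  classical
  set F : ℂ → ℝ≥0∞ := (Metric.ball c r).piecewise (fun z => ‖g z‖ₑ ^ 2) (fun _ => 0) with hF
  have hsub : Metric.ball c r ⊆ Metric.ball 0 1 := Metric.ball_subset_closedBall.trans hc
  have hFm : Measurable F := by
    apply ContinuousOn.measurable_piecewise
    · exact ((ENNReal.continuous_pow 2).comp continuous_enorm).comp_continuousOn
        (hg.continuousOn.mono hsub)
    · exact continuousOn_const
    · exact measurableSet_ball
  have h1 : ∫⁻ z, F z ≤ ∫⁻ z in Metric.ball (0 : ℂ) 1, ‖g z‖ₑ ^ 2 := by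
    have : F = (Metric.ball c r).indicator (fun z => ‖g z‖ₑ ^ 2) := by
      ext z; simp [hF, Set.piecewise, Set.indicator]
    rw [this, lintegral_indicator measurableSet_ball]
    exact lintegral_mono_set hsub
  refine le_trans ?_ h1
  rw [← lintegral_add_left_eq_self F c, ← Complex.lintegral_comp_polarCoord_symm]
  have hsub2 : Set.Ioo (r / 2) r ×ˢ Set.Ioo (-Real.pi) Real.pi ⊆ polarCoord.target := by
    rw [polarCoord_target]
    refine Set.prod_mono (fun x hx => ?_) subset_rfl
    exact lt_trans (by positivity) hx.1
  refine le_trans ?_ (lintegral_mono_set hsub2)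
  have hcirc : ∀ p : ℝ × ℝ, c + Complex.polarCoord.symm p = circleMap c p.1 p.2 := by
    intro p
    rw [Complex.polarCoord_symm_apply, circleMap, Complex.exp_mul_I, Complex.ofReal_cos,
      Complex.ofReal_sin]
  simp only [hcirc, smul_eq_mul]
  have hcm : Measurable fun p : ℝ × ℝ => circleMap c p.1 p.2 := by
    unfold circleMap
    fun_prop
  rw [Measure.volume_eq_prod, ← Measure.prod_restrict, lintegral_prod _ (by fun_prop)]
  have h4 : ∫⁻ _ρ in Set.Ioo (r / 2) r,
      ENNReal.ofReal (r / 2) * (ENNReal.ofReal (2 * Real.pi) * ‖g c‖ₑ ^ 2) =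
      ENNReal.ofReal (Real.pi * r ^ 2 / 2) * ‖g c‖ₑ ^ 2 := by
    rw [setLIntegral_const, Real.volume_Ioo, sub_half, mul_right_comm, ← mul_assoc,
      ← ENNReal.ofReal_mul (by positivity), ← ENNReal.ofReal_mul (by positivity)]
    congr 2
    ring
  rw [← h4]
  refine setLIntegral_mono' measurableSet_Ioo fun ρ hρ => ?_
  have hρ0 : 0 < ρ := lt_trans (by positivity) hρ.1
  dsimp only
  rw [lintegral_const_mul _ (by fun_prop)]
  refine mul_le_mul' (ENNReal.ofReal_le_ofReal hρ.1.le) ?_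
  refine (circle_bound hg hρ0.le ((Metric.closedBall_subset_closedBall hρ.2.le).trans hc)).trans ?_
  refine lintegral_mono fun θ => ?_
  have : circleMap c ρ θ ∈ Metric.ball c r := by
    rw [Metric.mem_ball, dist_eq_norm]
    simp [circleMap, abs_of_pos hρ0, hρ.2]
  simp [hF, this]

/-- The Bergman space `L²ₐ(𝔻)`: the (classes of) square integrable functions on the disk that are
analytic there, with the norm `‖f‖² = (1 / π) ∫_𝔻 |f|² dA` inherited from `L²`. -/
noncomputable def space : Submodule ℂ (Lp ℂ 2 diskMeasure) where
  carrier := {f | ∃ g : ℂ → ℂ, DifferentiableOn ℂ g (Metric.ball 0 1) ∧ f =ᵐ[diskMeasure] g}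
  add_mem' := by
    rintro f₁ f₂ ⟨g₁, h₁, e₁⟩ ⟨g₂, h₂, e₂⟩
    exact ⟨g₁ + g₂, h₁.add h₂, (Lp.coeFn_add f₁ f₂).trans (e₁.add e₂)⟩
  zero_mem' := ⟨0, differentiableOn_const 0, Lp.coeFn_zero ..⟩
  smul_mem' := by
    rintro a f ⟨g, h, e⟩
    exact ⟨a • g, h.const_smul a, (Lp.coeFn_smul a f).trans (e.const_smul a)⟩

theorem point_bound {f : Lp ℂ 2 diskMeasure} {g : ℂ → ℂ}
    (hg : DifferentiableOn ℂ g (Metric.ball 0 1)) (e : f =ᵐ[diskMeasure] g) {c : ℂ} {r : ℝ}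
    (hr : 0 < r) (hc : Metric.closedBall c r ⊆ Metric.ball 0 1) :
    r * ‖g c‖ ≤ 2 * ‖f‖ := by
  have h1 := area_bound hg hr hc
  have hpi := Real.pi_pos
  have h2 : ‖f‖ₑ ^ 2 = ENNReal.ofReal (Real.pi)⁻¹ * ∫⁻ z in Metric.ball (0 : ℂ) 1, ‖g z‖ₑ ^ 2 := by
    rw [Lp.enorm_def, eLpNorm_congr_ae e, eLpNorm_eq_lintegral_rpow_enorm_toReal (by simp) (by simp)]
    rw [← ENNReal.rpow_natCast, ← ENNReal.rpow_mul]
    simp [diskMeasure, lintegral_smul_measure]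
  have h3 : ENNReal.ofReal (r ^ 2 / 2) * ‖g c‖ₑ ^ 2 ≤ ‖f‖ₑ ^ 2 := by
    rw [h2]
    refine le_trans (le_of_eq ?_) (mul_le_mul_right h1 _)
    rw [← mul_assoc, ← ENNReal.ofReal_mul (by positivity)]
    congr 2
    field_simp
  rw [← ofReal_norm, ← ofReal_norm, ← ENNReal.ofReal_pow (by positivity),
    ← ENNReal.ofReal_pow (by positivity), ← ENNReal.ofReal_mul (by positivity),
    ENNReal.ofReal_le_ofReal_iff (by positivity)] at h3
  refine abs_le_of_sq_le_sq' ?_ (by positivity) |>.2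
  nlinarith [sq_nonneg ‖f‖]

theorem isClosed_space : IsClosed (space : Set (Lp ℂ 2 diskMeasure)) := by
  apply IsSeqClosed.isClosed
  intro f F hf hF
  choose g hg e using hf
  have hcau : ∀ K ⊆ Metric.ball (0 : ℂ) 1, IsCompact K → UniformCauchySeqOn g atTop K := by
    intro K hK hKc
    obtain ⟨r, hr, hrK⟩ := hKc.exists_cthickening_subset_open Metric.isOpen_ball hK
    rw [Metric.uniformCauchySeqOn_iff]
    intro ε hε
    obtain ⟨N, hN⟩ := Metric.cauchySeq_iff.1 hF.cauchySeq (ε * r / 2) (by positivity)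
    refine ⟨N, fun m hm n hn x hx => ?_⟩
    have h1 := hN m hm n hn
    rw [dist_eq_norm] at h1 ⊢
    have e' : (f m - f n : Lp ℂ 2 diskMeasure) =ᵐ[diskMeasure] g m - g n :=
      (Lp.coeFn_sub _ _).trans ((e m).sub (e n))
    have h2 := point_bound ((hg m).sub (hg n)) e' hr
      ((Metric.closedBall_subset_cthickening hx r).trans hrK)
    simp only [Pi.sub_apply] at h2
    by_contra! h3
    nlinarith
  have hlim : ∀ z ∈ Metric.ball (0 : ℂ) 1, ∃ w, Tendsto (fun n => g n z) atTop (𝓝 w) := by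
    intro z hz
    exact cauchySeq_tendsto_of_complete
      ((hcau {z} (by simpa using hz) isCompact_singleton).cauchySeq (by simp))
  choose! G hG using hlim
  refine ⟨G, ?_, ?_⟩
  · refine TendstoLocallyUniformlyOn.differentiableOn (F := g) (φ := atTop) ?_
      (Eventually.of_forall hg) Metric.isOpen_ball
    rw [tendstoLocallyUniformlyOn_iff_forall_isCompact Metric.isOpen_ball]
    intro K hK hKc
    exact (hcau K hK hKc).tendstoUniformlyOn_of_tendsto fun x hx => hG x (hK hx)
  · obtain ⟨ns, hns, hae⟩ := (tendstoInMeasure_of_tendsto_Lp hF).exists_seq_tendsto_ae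
    have hb : ∀ᵐ z ∂diskMeasure, z ∈ Metric.ball (0 : ℂ) 1 :=
      ae_iff_diskMeasure.2 (ae_restrict_mem measurableSet_ball)
    filter_upwards [hae, hb, ae_all_iff.2 e] with z h1 h2 h3
    refine tendsto_nhds_unique h1 ?_
    simp only [h3]
    exact (hG z h2).comp hns.tendsto_atTop

instance instCompleteSpace : CompleteSpace space := isClosed_space.completeSpace_coe

/-- The Toeplitz operator `f ↦ P (u f)` with bounded symbol `u`, where `P` is the orthogonal
projection of `L²(𝔻)` onto the Bergman space. -/
noncomputable def toeplitz (u : ℂ → ℂ) (hu : MemLp u ∞ diskMeasure) : space →L[ℂ] space :=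
  space.orthogonalProjectionOnto ∘L
    ((ContinuousLinearMap.mul ℂ ℂ).holderL diskMeasure ∞ 2 2 (hu.toLp u)) ∘L space.subtypeL

/-- The symbol `1 - |z|²`. -/
noncomputable def symbol (z : ℂ) : ℂ := 1 - (‖z‖ : ℂ) ^ 2

theorem memLp_symbol : MemLp symbol ∞ diskMeasure := by
  have hc : Continuous symbol := by
    unfold symbol
    fun_prop
  refine memLp_top_of_bound hc.aestronglyMeasurable 1
    (ae_iff_diskMeasure.2 ((ae_restrict_mem measurableSet_ball).mono fun z hz => ?_))
  have hz1 : ‖z‖ < 1 := by simpa using hz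
  have h : symbol z = ((1 - ‖z‖ ^ 2 : ℝ) : ℂ) := by simp [symbol]
  rw [h, Complex.norm_real, Real.norm_eq_abs, abs_le]
  constructor <;> nlinarith [norm_nonneg z]

/-- The Toeplitz operator on the Bergman space with symbol `1 - |z|²`. -/
noncomputable def X : space →L[ℂ] space := toeplitz symbol memLp_symbol

end Bergman

/-! Everything reduces to the fact that `X` is diagonal in the monomial basis. For `g` analytic on
the disk with Taylor coefficients `p m`, polar coordinates and Cauchy's formula give the moment of
`g` against `conj z ^ m * ‖z‖ ^ (2 * k)` as `p m / (m + k + 1)` (`integral_weight_mul`). The case `k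
= 0` makes the monomials orthonormal and complete. Subtracting the case `k = 1` evaluates the
symbol, and the ratio of `1/(m+1) - 1/(m+2)` to `1/(m+1)` is the eigenvalue `1/(m+2)`.

The rest is about an operator diagonal in a Hilbert basis. Parseval bounds its norm by the supremum
of its entries, so the diagonal series converges in norm when the entries tend to zero, and
compactness follows. Its functional calculus acts entrywise, its trace is the sum of its nonnegative
entries in any basis, and its singular values are its entries once these are nonnegative and
decreasing (`singularValue_diagonal`).

The claims on Orlicz and Schatten classes then concern the sequence `1/(n+2)`. Under `δ₂` the
modular `t ↦ ∑ φ (t * w n)` is finite on tails, hence continuous by dominated convergence, so it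
takes the value one, and it does so at the reciprocal of the Luxemburg norm (`luxemburg_attained`).
For powers, homogeneity gives the norm explicitly. -/

theorem HasSum.swap_of_nonneg {α β : Type*} {f : α → β → ℝ} (hf : ∀ a b, 0 ≤ f a b) {g : α → ℝ}
    {h : β → ℝ} {A : ℝ} (hg : ∀ a, HasSum (f a) (g a)) (hh : ∀ b, HasSum (fun a => f a b) (h b))
    (hA : HasSum g A) : HasSum h A := by
  have hs : Summable (fun p : α × β => f p.1 p.2) := by
    rw [summable_prod_of_nonneg fun p => hf p.1 p.2]
    refine ⟨fun a => (hg a).summable, ?_⟩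
    simpa only [(hg _).tsum_eq] using hA.summable
  have h1 : (∑' p : α × β, f p.1 p.2) = A := (hs.hasSum.prod_fiberwise hg).unique hA
  have h2 : HasSum (fun p : β × α => f p.2 p.1) A := by
    rw [← h1]
    exact (Equiv.prodComm β α).hasSum_iff.2 hs.hasSum
  exact h2.prod_fiberwise hh

/-! ### Operators diagonal in a Hilbert basis. -/

namespace HilbertBasis

variable {ι H : Type*} [NormedAddCommGroup H] [InnerProductSpace ℂ H]

theorem hasSum_norm_inner_sq (e : HilbertBasis ι ℂ H) (x : H) :
    HasSum (fun i => ‖⟪e i, x⟫_ℂ‖ ^ 2) (‖x‖ ^ 2) := by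
  have h := Complex.hasSum_re (e.hasSum_inner_mul_inner x x)
  have h2 : (⟪x, x⟫_ℂ).re = ‖x‖ ^ 2 := inner_self_eq_norm_sq (𝕜 := ℂ) x
  rw [h2] at h
  refine h.congr_fun fun i => ?_
  rw [← inner_conj_symm x, ← Complex.normSq_eq_conj_mul_self, Complex.ofReal_re,
    Complex.normSq_eq_norm_sq]

theorem ext_inner (e : HilbertBasis ι ℂ H) {x y : H} (h : ∀ i, ⟪e i, x⟫_ℂ = ⟪e i, y⟫_ℂ) :
    x = y := by
  refine e.repr.injective (Subtype.ext (funext fun i => ?_))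
  simpa only [e.repr_apply_apply] using h i

theorem ext_clm (e : HilbertBasis ι ℂ H) {F : Type*} [NormedAddCommGroup F] [NormedSpace ℂ F]
    {S T : H →L[ℂ] F} (h : ∀ i, S (e i) = T (e i)) : S = T := by
  refine ContinuousLinearMap.ext_on (s := Set.range e) ?_ ?_
  · rw [Submodule.dense_iff_topologicalClosure_eq_top, e.dense_span]
  · rintro _ ⟨i, rfl⟩
    exact h i

variable {e : HilbertBasis ι ℂ H} {T : H →L[ℂ] H} {a : ι → ℂ}

/-- Both sides are continuous linear functionals of `x` that agree on the basis; no adjoint of `T`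
is needed. -/
theorem inner_diagonal (hT : ∀ i, T (e i) = a i • e i) (i : ι) (x : H) :
    ⟪e i, T x⟫_ℂ = a i * ⟪e i, x⟫_ℂ := by
  classical
  have h : (innerSL ℂ (e i)) ∘L T = a i • innerSL ℂ (e i) := by
    refine e.ext_clm fun j => ?_
    simp only [ContinuousLinearMap.comp_apply, hT, map_smul, innerSL_apply_apply,
      smul_apply, smul_eq_mul, orthonormal_iff_ite.1 e.orthonormal i j]
    split_ifs with hij
    · rw [hij]
    · simp
  simpa using DFunLike.congr_fun h x

theorem norm_diagonal_le (hT : ∀ i, T (e i) = a i • e i) {C : ℝ} (hC : 0 ≤ C)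
    (ha : ∀ i, ‖a i‖ ≤ C) : ‖T‖ ≤ C := by
  refine T.opNorm_le_bound hC fun x => ?_
  refine (sq_le_sq₀ (norm_nonneg _) (by positivity)).1 ?_
  rw [mul_pow]
  refine hasSum_le (fun i => ?_) (e.hasSum_norm_inner_sq (T x))
    ((e.hasSum_norm_inner_sq x).mul_left (C ^ 2))
  rw [inner_diagonal hT, norm_mul, mul_pow]
  gcongr
  exact ha i

/-- `T` minus the partial sum over `s` is again diagonal, with the entries indexed by `s` replaced
by zero, so `norm_diagonal_le` bounds the error by the entries off `s`. -/
theorem hasSum_diagonal (hT : ∀ i, T (e i) = a i • e i) (ha : Tendsto a cofinite (𝓝 0)) :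
    HasSum (fun i => a i • InnerProductSpace.rankOne ℂ (e i) (e i)) T := by
  classical
  rw [HasSum, SummationFilter.unconditional_filter, Metric.tendsto_nhds]
  intro ε hε
  have hfin : {i | ¬ ‖a i‖ < ε / 2}.Finite := by
    have := (Metric.tendsto_nhds.1 ha) (ε / 2) (by positivity)
    simpa using this
  filter_upwards [eventually_ge_atTop hfin.toFinset] with s hs
  rw [dist_comm, dist_eq_norm]
  have hd : ∀ i, (T - ∑ j ∈ s, a j • InnerProductSpace.rankOne ℂ (e j) (e j)) (e i) =
      (if i ∈ s then 0 else a i) • e i := by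
    intro i
    have : (∑ j ∈ s, a j • InnerProductSpace.rankOne ℂ (e j) (e j)) (e i) =
        ∑ j ∈ s, if j = i then a i • e i else 0 := by
      rw [sum_apply]
      refine Finset.sum_congr rfl fun j _ => ?_
      rw [smul_apply, InnerProductSpace.rankOne_apply,
        orthonormal_iff_ite.1 e.orthonormal j i]
      split_ifs with h
      · rw [h, one_smul]
      · simp
    rw [sub_apply, this, hT, Finset.sum_ite_eq']
    split_ifs <;> simp
  refine (norm_diagonal_le hd (C := ε / 2) (by positivity) fun i => ?_).trans_lt (by linarith)
  split_ifs with h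
  · simp only [norm_zero]; positivity
  · by_contra! hc
    exact h (hs (by simpa using hc.le))

theorem isCompactOperator_rankOne {x y : H} :
    IsCompactOperator (InnerProductSpace.rankOne ℂ x y : H →L[ℂ] H) := by
  rw [InnerProductSpace.rankOne_def']
  have h : IsCompactOperator (ContinuousLinearMap.id ℂ ℂ) := isCompactOperator_id
  exact (h.comp_clm (innerSL ℂ y)).clm_comp (ContinuousLinearMap.toSpanSingleton ℂ x)

theorem isCompactOperator_diagonal [CompleteSpace H] (hT : ∀ i, T (e i) = a i • e i)
    (ha : Tendsto a cofinite (𝓝 0)) : IsCompactOperator T := by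
  refine isCompactOperator_of_tendsto (hasSum_diagonal hT ha) (Eventually.of_forall fun s => ?_)
  exact Submodule.sum_mem (compactOperator (RingHom.id ℂ) H H) fun i _ =>
    Submodule.smul_mem _ _ isCompactOperator_rankOne

section Real

variable {r : ι → ℝ}

open scoped ComplexOrder in
theorem isPositive_diagonal (hT : ∀ i, T (e i) = (r i : ℂ) • e i) (hr : ∀ i, 0 ≤ r i) :
    T.IsPositive := by
  rw [ContinuousLinearMap.isPositive_iff]
  have key : ∀ x y : H, HasSum (fun i => (r i : ℂ) * (⟪x, e i⟫_ℂ * ⟪e i, y⟫_ℂ)) ⟪x, T y⟫_ℂ := by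
    intro x y
    refine (e.hasSum_inner_mul_inner x (T y)).congr_fun fun i => ?_
    rw [inner_diagonal hT]
    ring
  have key' : ∀ x y : H, HasSum (fun i => (r i : ℂ) * (⟪x, e i⟫_ℂ * ⟪e i, y⟫_ℂ)) ⟪T x, y⟫_ℂ := by
    intro x y
    refine (e.hasSum_inner_mul_inner (T x) y).congr_fun fun i => ?_
    rw [← inner_conj_symm (T x), inner_diagonal hT, map_mul, inner_conj_symm, Complex.conj_ofReal]
    ring
  refine ⟨fun x y => (key' x y).unique (key x y), fun x => ?_⟩
  refine HasSum.nonneg (fun i => ?_) (key' x x)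
  rw [← inner_conj_symm x, ← Complex.normSq_eq_conj_mul_self, ← Complex.ofReal_mul,
    Complex.zero_le_real]
  exact mul_nonneg (hr i) (Complex.normSq_nonneg _)

open scoped ComplexOrder in
-- In the double series with terms `r i * ‖⟪e i, f k⟫‖ ^ 2`, summing over `i` gives `⟪f k, T (f k)⟫`
-- and summing over `k` gives `r i` by Parseval. Nonnegativity allows the interchange.
theorem hasTrace_diagonal [CompleteSpace H] (hT : ∀ i, T (e i) = (r i : ℂ) • e i)
    (hr : ∀ i, 0 ≤ r i) {A : ℝ} (hA : HasSum r A) : HilbertOp.HasTrace T (A : ℂ) := by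
  intro κ f
  have h1 : ∀ k, HasSum (fun i => r i * ‖⟪e i, f k⟫_ℂ‖ ^ 2) (⟪f k, T (f k)⟫_ℂ).re := by
    intro k
    refine (Complex.hasSum_re (e.hasSum_inner_mul_inner (f k) (T (f k)))).congr_fun fun i => ?_
    rw [inner_diagonal hT, ← inner_conj_symm (f k), mul_left_comm,
      ← Complex.normSq_eq_conj_mul_self, ← Complex.ofReal_mul, Complex.ofReal_re,
      Complex.normSq_eq_norm_sq]
  have h2 : ∀ i, HasSum (fun k => r i * ‖⟪e i, f k⟫_ℂ‖ ^ 2) (r i) := by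
    intro i
    have := (f.hasSum_norm_inner_sq (e i)).mul_left (r i)
    simp only [e.orthonormal.1 i, one_pow, mul_one] at this
    refine this.congr_fun fun k => ?_
    rw [← inner_conj_symm, RCLike.norm_conj]
  have h3 := HasSum.swap_of_nonneg (fun i k => mul_nonneg (hr i) (sq_nonneg _)) h2 h1 hA
  refine (Complex.hasSum_ofReal.2 h3).congr_fun fun k => ?_
  -- The interchange was done for real parts; positivity of `T` makes the diagonal coefficients
  -- real.
  have := ((isPositive_diagonal hT hr).inner_nonneg_right (f k))
  rw [Complex.nonneg_iff] at this
  exact Complex.ext (by simp) (by simp [← this.2])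

end Real

end HilbertBasis

/-! ### Functional calculus on eigenvectors and singular values. -/

namespace HilbertOp

variable {H : Type*} [NormedAddCommGroup H] [InnerProductSpace ℂ H] [CompleteSpace H]

/-- Stone–Weierstrass: the property holds for constants and the identity, passes to sums and
products, and is closed under uniform limits. -/
theorem cfcHom_apply_of_eigenvector {T : H →L[ℂ] H} (hT : IsSelfAdjoint T) {μ : ℝ} {x : H}
    (hx : T x = (μ : ℂ) • x) (hμ : μ ∈ spectrum ℝ T) (f : C(spectrum ℝ T, ℝ)) :
    cfcHom hT f x = ((f ⟨μ, hμ⟩ : ℝ) : ℂ) • x := by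
  induction f using ContinuousMap.induction_on_of_compact with
  | const r =>
    have : ContinuousMap.const (spectrum ℝ T) r = algebraMap ℝ _ r := rfl
    rw [this, AlgHomClass.commutes]
    simp [Algebra.algebraMap_eq_smul_one]
  | id => rw [cfcHom_id]; exact hx
  | star_id => rw [map_star, cfcHom_id, hT.star_eq]; exact hx
  | add f g hf hg =>
    rw [map_add, add_apply, hf, hg, ← add_smul]; simp
  | mul f g hf hg =>
    rw [map_mul, mul_apply_eq_comp, hg, map_smul, hf, smul_smul, mul_comm]; simp
  | frequently f h =>
    refine h.mem_of_closed (isClosed_eq ?_ ?_)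
    · exact (ContinuousLinearMap.apply ℂ H x).continuous.comp (cfcHom_continuous hT)
    · fun_prop

theorem mem_spectrum_of_eigenvector {H : Type*} [NormedAddCommGroup H] [InnerProductSpace ℂ H]
    {T : H →L[ℂ] H} {μ : ℝ} {x : H}
    (hx : T x = (μ : ℂ) • x) (hx0 : x ≠ 0) : μ ∈ spectrum ℝ T := by
  rw [spectrum.mem_iff]
  intro hu
  obtain ⟨u, hu⟩ := hu
  have h0 : (u : H →L[ℂ] H) x = 0 := by
    rw [hu]; simp [Algebra.algebraMap_eq_smul_one, hx]
  have : x = (↑u⁻¹ * ↑u : H →L[ℂ] H) x := by simp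
  rw [mul_apply_eq_comp, h0, map_zero] at this
  exact hx0 this

theorem cfc_nnreal_apply_of_eigenvector {T : H →L[ℂ] H} (hT : 0 ≤ T) {μ : ℝ≥0} {x : H}
    (hx : T x = ((μ : ℝ) : ℂ) • x) {f : ℝ≥0 → ℝ≥0} (hf : ContinuousOn f (spectrum ℝ≥0 T)) :
    cfc f T x = ((f μ : ℝ) : ℂ) • x := by
  by_cases hx0 : x = 0
  · simp [hx0]
  have hsa : IsSelfAdjoint T := IsSelfAdjoint.of_nonneg hT
  have hc : ContinuousOn (fun t : ℝ => (f t.toNNReal : ℝ)) (spectrum ℝ T) := by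
    refine NNReal.continuous_coe.comp_continuousOn (hf.comp continuous_real_toNNReal.continuousOn ?_)
    intro t ht
    have := (SpectrumRestricts.nnreal_of_nonneg hT)
    rw [← this.image]
    exact ⟨t, ht, rfl⟩
  rw [cfc_nnreal_eq_real f T hT, cfc_apply _ T hsa hc,
    cfcHom_apply_of_eigenvector hsa hx (mem_spectrum_of_eigenvector hx hx0)]
  simp

theorem le_norm_of_mem_spectrum_nnreal {T : H →L[ℂ] H} {t : ℝ≥0} (ht : t ∈ spectrum ℝ≥0 T) :
    (t : ℝ) ≤ ‖T‖ := by
  have h := spectrum.norm_le_norm_mul_of_mem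
    ((spectrum.algebraMap_mem_iff (S := ℝ) (A := H →L[ℂ] H)).2 ht)
  have ht' : ‖algebraMap ℝ≥0 ℝ t‖ = t := Real.norm_of_nonneg t.2
  rw [ht'] at h
  exact h.trans (mul_le_of_le_one_right (norm_nonneg _) ContinuousLinearMap.norm_id_le)

/-- The set whose infimum is taken is exactly `Set.Ici (s n)`. If `t < s n`, the vectors `e 0, …, e
n` lie in the span of the eigenspaces above `t`, so its rank exceeds `n`. If `s n ≤ t`, an
eigenvector for some `μ > t` is orthogonal to `e m` for all `m ≥ n`, so this span lies in that of `e
0, …, e (n - 1)`. -/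
theorem singularValue_diagonal {e : HilbertBasis ℕ ℂ H} {T : H →L[ℂ] H} {s : ℕ → ℝ≥0}
    (hs : Antitone s) (hT : ∀ n, T (e n) = ((s n : ℝ) : ℂ) • e n) (n : ℕ) :
    singularValue T n = s n := by
  have habs : CFC.abs T = T := CFC.abs_of_nonneg T
    ((ContinuousLinearMap.nonneg_iff_isPositive T).2
      (HilbertBasis.isPositive_diagonal hT fun i => (s i).2))
  have hset : {t : ℝ≥0 | Module.rank ℂ
      (⨆ μ : Set.Ioi t, Module.End.eigenspace ((CFC.abs T : H →L[ℂ] H) : Module.End ℂ H)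
      (((μ : ℝ≥0) : ℝ) : ℂ) : Submodule ℂ H) ≤ n} = Set.Ici (s n) := by
    rw [habs]
    ext t
    simp only [Set.mem_ofPred_eq, Set.mem_Ici]
    constructor
    · intro h
      by_contra! hlt
      set V := (⨆ μ : Set.Ioi t, Module.End.eigenspace (T : Module.End ℂ H)
        (((μ : ℝ≥0) : ℝ) : ℂ) : Submodule ℂ H)
      have hmem : ∀ i : Fin (n + 1), e i ∈ V := by
        intro i
        refine Submodule.mem_iSup_of_mem
          ⟨s i, hlt.trans_le (hs (Nat.lt_succ_iff.1 i.2))⟩ ?_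
        rw [Module.End.mem_eigenspace_iff]
        exact hT i
      have hli : LinearIndependent ℂ (fun i : Fin (n + 1) => (⟨e i, hmem i⟩ : V)) := by
        refine LinearIndependent.of_comp V.subtype ?_
        exact e.orthonormal.linearIndependent.comp (fun i : Fin (n + 1) => (i : ℕ))
          Fin.val_injective
      have := hli.cardinal_lift_le_rank.trans (Cardinal.lift_le.2 h)
      rw [Cardinal.mk_fin, Cardinal.lift_natCast, Cardinal.lift_natCast] at this
      exact absurd (Nat.cast_le.1 this) (by lia)
    · intro hle
      classical
      have hsub : (⨆ μ : Set.Ioi t, Module.End.eigenspace (T : Module.End ℂ H)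
          (((μ : ℝ≥0) : ℝ) : ℂ) : Submodule ℂ H) ≤
          Submodule.span ℂ (((Finset.range n).image e : Finset H) : Set H) := by
        refine iSup_le fun μ x hx => ?_
        rw [Module.End.mem_eigenspace_iff] at hx
        have h0 : ∀ m, n ≤ m → ⟪e m, x⟫_ℂ = 0 := by
          intro m hm
          have h1 := HilbertBasis.inner_diagonal hT m x
          have h2 : T x = ((((μ : ℝ≥0) : ℝ) : ℂ)) • x := hx
          rw [h2, inner_smul_right, ← sub_eq_zero, ← sub_mul, mul_eq_zero] at h1
          refine h1.resolve_left ?_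
          have : s m < (μ : ℝ≥0) := ((hs hm).trans hle).trans_lt μ.2
          exact sub_ne_zero.2 (by exact_mod_cast this.ne')
        have hxs : x = ∑ m ∈ Finset.range n, e.repr x m • e m := by
          refine (e.hasSum_repr x).unique (hasSum_sum_of_ne_finset_zero fun m hm => ?_)
          rw [e.repr_apply_apply, h0 m (by simpa using hm), zero_smul]
        rw [hxs]
        refine Submodule.sum_mem _ fun m hm => Submodule.smul_mem _ _ (Submodule.subset_span ?_)
        exact Finset.mem_coe.2 (Finset.mem_image_of_mem _ hm)
      refine (Submodule.rank_mono hsub).trans ((rank_span_finset_le _).trans ?_)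
      exact_mod_cast Finset.card_image_le.trans (Finset.card_range n).le
  rw [singularValue, hset, csInf_Ici]

end HilbertOp

/-! ### Integration over the disk in polar coordinates. -/

theorem Real.circleAverage_eq_integral_Ioo (f : ℂ → ℂ) (c : ℂ) (r : ℝ) :
    Real.circleAverage f c r =
      (2 * Real.pi)⁻¹ • ∫ θ in Set.Ioo (-Real.pi) Real.pi, f (circleMap c r θ) := by
  have hpi := Real.pi_pos
  rw [Real.circleAverage_eq_integral_add (-Real.pi),
    intervalIntegral.integral_comp_add_right (fun θ => f (circleMap c r θ))]
  have e1 : (0 + -Real.pi) = -Real.pi := by ring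
  have e2 : (2 * Real.pi + -Real.pi) = Real.pi := by ring
  rw [e1, e2, intervalIntegral.integral_of_le (by linarith), integral_Ioc_eq_integral_Ioo]

theorem Complex.polarCoord_symm_eq_circleMap (p : ℝ × ℝ) :
    Complex.polarCoord.symm p = circleMap 0 p.1 p.2 := by
  rw [Complex.polarCoord_symm_apply, circleMap_zero, Complex.exp_mul_I, Complex.ofReal_cos,
    Complex.ofReal_sin]

/-- Integration over the unit disk in polar coordinates. -/
theorem Complex.integral_unitBall_eq_polar {f : ℂ → ℂ} (hc : ContinuousOn f (Metric.ball 0 1))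
    (hf : IntegrableOn f (Metric.ball 0 1)) :
    ∫ z in Metric.ball (0 : ℂ) 1, f z =
      ∫ r in Set.Ioo (0 : ℝ) 1, (r : ℂ) *
        ∫ θ in Set.Ioo (-Real.pi) Real.pi, f (circleMap 0 r θ) := by
  classical
  have hcirc := Complex.polarCoord_symm_eq_circleMap
  set S : Set (ℝ × ℝ) := Set.Ioo 0 1 ×ˢ Set.Ioo (-Real.pi) Real.pi with hS
  have hSm : MeasurableSet S := measurableSet_Ioo.prod measurableSet_Ioo
  have hST : S ⊆ polarCoord.target := by
    rw [polarCoord_target]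
    exact Set.prod_mono (fun x hx => hx.1) subset_rfl
  have hmem : ∀ p ∈ polarCoord.target, (circleMap 0 p.1 p.2 ∈ Metric.ball (0 : ℂ) 1 ↔ p ∈ S) := by
    rintro ⟨r, θ⟩ hp
    rw [polarCoord_target] at hp
    have hr : 0 < r := hp.1
    simp [hS, abs_of_pos hr, hr, hp.2.1, hp.2.2]
  have hcm : Continuous fun p : ℝ × ℝ => circleMap 0 p.1 p.2 := by
    unfold circleMap
    fun_prop
  -- Fubini needs joint integrability, which comes from the polar formula for the lower integral of
  -- `‖f‖ₑ`.
  have hint : IntegrableOn (fun p : ℝ × ℝ => (p.1 : ℂ) * f (circleMap 0 p.1 p.2)) S := by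
    refine ⟨ContinuousOn.aestronglyMeasurable ?_ hSm, ?_⟩
    · refine ContinuousOn.mul (by fun_prop) (hc.comp hcm.continuousOn fun p hp => ?_)
      exact (hmem p (hST hp)).2 hp
    · have h1 := Complex.lintegral_comp_polarCoord_symm
        ((Metric.ball (0 : ℂ) 1).indicator fun z => ‖f z‖ₑ)
      rw [lintegral_indicator measurableSet_ball] at h1
      refine lt_of_le_of_lt ?_ (h1.trans_lt hf.2)
      refine le_trans (le_of_eq ?_) (lintegral_mono_set hST)
      refine setLIntegral_congr_fun hSm fun p hp => ?_
      have hp' := (hmem p (hST hp)).2 hp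
      simp only [hcirc, Set.indicator_of_mem hp', enorm_mul, smul_eq_mul]
      congr 1
      rw [← ofReal_norm, Complex.norm_real, Real.norm_of_nonneg hp.1.1.le]
  rw [← integral_indicator measurableSet_ball, ← Complex.integral_comp_polarCoord_symm]
  have h2 : ∫ p in polarCoord.target, p.1 •
      (Metric.ball (0 : ℂ) 1).indicator f (Complex.polarCoord.symm p) =
      ∫ p in S, (p.1 : ℂ) * f (circleMap 0 p.1 p.2) := by
    rw [setIntegral_eq_of_subset_of_forall_sdiff_eq_zero
      (polarCoord.open_target.measurableSet) hST (fun p hp => ?_)]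
    · refine setIntegral_congr_fun hSm fun p hp => ?_
      simp only [hcirc, Set.indicator_of_mem ((hmem p (hST hp)).2 hp), Complex.real_smul]
    · have : circleMap 0 p.1 p.2 ∉ Metric.ball (0 : ℂ) 1 := fun h => hp.2 ((hmem p hp.1).1 h)
      simp only [hcirc, Set.indicator_of_notMem this, smul_zero]
  rw [h2, hS, Measure.volume_eq_prod, setIntegral_prod _ hint]
  exact setIntegral_congr_fun measurableSet_Ioo fun r _ =>
    integral_const_mul (r : ℂ) fun θ : ℝ => f (circleMap 0 r θ)

/-! ### Moments of analytic functions, the monomial basis and the diagonalisation of `X`. -/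

namespace Bergman

/-- On the circle of radius `r` one has `conj z = r ^ 2 / z`, which turns the integral into Cauchy's
formula for the `m`-th Taylor coefficient. -/
theorem integral_circle_conj_pow_mul {g : ℂ → ℂ} (hg : DifferentiableOn ℂ g (Metric.ball 0 1))
    {p : ℕ → ℂ} (hp : ∀ z ∈ Metric.ball (0 : ℂ) 1, HasSum (fun n => p n * z ^ n) (g z))
    {r : ℝ} (hr0 : 0 < r) (hr1 : r < 1) (m : ℕ) :
    ∫ θ in Set.Ioo (-Real.pi) Real.pi,
      (starRingEnd ℂ) (circleMap 0 r θ) ^ m * g (circleMap 0 r θ) =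
      2 * Real.pi * (r : ℂ) ^ (2 * m) * p m := by
  have hsub : Metric.closedBall (0 : ℂ) r ⊆ Metric.ball 0 1 := Metric.closedBall_subset_ball hr1
  have h1 : HasFPowerSeriesAt g (cauchyPowerSeries g 0 r) 0 :=
    ((hg.mono hsub).hasFPowerSeriesOnBall (R := ⟨r, hr0.le⟩) hr0).hasFPowerSeriesAt
  have h2 : HasFPowerSeriesAt g (FormalMultilinearSeries.ofScalars ℂ p) 0 := by
    rw [hasFPowerSeriesAt_iff]
    filter_upwards [Metric.ball_mem_nhds (0 : ℂ) one_pos] with z hz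
    simpa [FormalMultilinearSeries.coeff_ofScalars, mul_comm] using hp z hz
  -- Uniqueness of the power series at `0` identifies the Cauchy coefficients with the given `p`.
  have h3 : (cauchyPowerSeries g 0 r).coeff m = p m := by
    rw [h1.eq_formalMultilinearSeries h2, FormalMultilinearSeries.coeff_ofScalars]
  have h4 : (cauchyPowerSeries g 0 r).coeff m =
      Real.circleAverage (fun z => (z⁻¹) ^ m * g z) 0 r := by
    rw [Real.circleAverage_eq_circleIntegral hr0.ne']
    have := cauchyPowerSeries_apply g 0 r m 1
    simp only [sub_zero, one_div, smul_eq_mul] at this ⊢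
    refine this.trans ?_
    congr 2
    ext z
    ring
  rw [h3, Real.circleAverage_eq_integral_Ioo] at h4
  have hpi : (Real.pi : ℂ) ≠ 0 := by exact_mod_cast Real.pi_ne_zero
  have hr : (r : ℂ) ≠ 0 := by exact_mod_cast hr0.ne'
  rw [h4]
  have h5 : ∀ θ : ℝ, (starRingEnd ℂ) (circleMap 0 r θ) ^ m * g (circleMap 0 r θ) =
      (r : ℂ) ^ (2 * m) * ((circleMap 0 r θ)⁻¹ ^ m * g (circleMap 0 r θ)) := by
    intro θ
    have h6 : (starRingEnd ℂ) (circleMap 0 r θ) = (r : ℂ) ^ 2 * (circleMap 0 r θ)⁻¹ := by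
      rw [Complex.inv_def, Complex.normSq_eq_norm_sq, norm_circleMap_zero, sq_abs]
      push_cast
      field_simp
    rw [h6, mul_pow, pow_mul]
    ring
  simp only [h5]
  rw [integral_const_mul, Complex.real_smul]
  push_cast
  field_simp

theorem hasSum_taylor {g : ℂ → ℂ} (hg : DifferentiableOn ℂ g (Metric.ball 0 1)) {z : ℂ}
    (hz : z ∈ Metric.ball (0 : ℂ) 1) :
    HasSum (fun n : ℕ => ((n.factorial : ℂ)⁻¹ * iteratedDeriv n g 0) * z ^ n) (g z) := by
  refine (Complex.hasSum_taylorSeries_on_ball hg hz).congr_fun fun n => ?_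
  simp only [sub_zero, smul_eq_mul]
  ring

instance instIsFiniteMeasureDiskMeasure : IsFiniteMeasure diskMeasure := by
  have : IsFiniteMeasure (volume.restrict (Metric.ball (0 : ℂ) 1)) :=
    ⟨by simp⟩
  unfold diskMeasure
  exact Measure.smul_finite _ ENNReal.ofReal_ne_top

theorem ae_mem_ball : ∀ᵐ z ∂diskMeasure, z ∈ Metric.ball (0 : ℂ) 1 :=
  ae_iff_diskMeasure.2 (ae_restrict_mem measurableSet_ball)

theorem integral_diskMeasure (f : ℂ → ℂ) :
    ∫ z, f z ∂diskMeasure = (Real.pi : ℂ)⁻¹ * ∫ z in Metric.ball (0 : ℂ) 1, f z := by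
  rw [diskMeasure, integral_smul_measure, ENNReal.toReal_ofReal (by positivity), Complex.real_smul]
  push_cast
  rfl

theorem integrable_weight_mul {g : ℂ → ℂ} (hg : MemLp g 2 diskMeasure) (m k : ℕ) :
    Integrable (fun z => ((starRingEnd ℂ) z ^ m * (‖z‖ : ℂ) ^ (2 * k)) * g z) diskMeasure := by
  refine (hg.integrable (by norm_num)).bdd_mul (c := 1) ?_ ?_
  · exact Continuous.aestronglyMeasurable (by fun_prop)
  · filter_upwards [ae_mem_ball] with z hz
    have hz1 : ‖z‖ ≤ 1 := by simpa using (mem_ball_zero_iff.1 hz).le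
    simp only [norm_mul, norm_pow, RCLike.norm_conj, Complex.norm_real, norm_norm]
    exact mul_le_one₀ (pow_le_one₀ (norm_nonneg _) hz1) (by positivity)
      (pow_le_one₀ (norm_nonneg _) hz1)

/-- The angular integral contributes `2π * r ^ (2m + 2k) * p m`; with the Jacobian `r` and the
factor `1/π`, the radial integral leaves `2 / (2(m + k) + 2)`. -/
theorem integral_weight_mul {g : ℂ → ℂ} (hg : DifferentiableOn ℂ g (Metric.ball 0 1))
    (hL : MemLp g 2 diskMeasure) {p : ℕ → ℂ}
    (hp : ∀ z ∈ Metric.ball (0 : ℂ) 1, HasSum (fun n => p n * z ^ n) (g z)) (m k : ℕ) :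
    ∫ z, ((starRingEnd ℂ) z ^ m * (‖z‖ : ℂ) ^ (2 * k)) * g z ∂diskMeasure =
      p m / (m + k + 1) := by
  have hint : IntegrableOn (fun z => ((starRingEnd ℂ) z ^ m * (‖z‖ : ℂ) ^ (2 * k)) * g z)
      (Metric.ball 0 1) := by
    have := integrable_weight_mul hL m k
    rw [diskMeasure] at this
    exact (integrable_smul_measure (by simp [Real.pi_pos]) ENNReal.ofReal_ne_top).1 this
  rw [integral_diskMeasure, Complex.integral_unitBall_eq_polar _ hint]
  · have h1 : ∀ r ∈ Set.Ioo (0 : ℝ) 1, (r : ℂ) * ∫ θ in Set.Ioo (-Real.pi) Real.pi,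
        ((starRingEnd ℂ) (circleMap 0 r θ) ^ m * (‖circleMap 0 r θ‖ : ℂ) ^ (2 * k)) *
          g (circleMap 0 r θ) = (2 * Real.pi * p m) * ((r ^ (2 * (m + k) + 1) : ℝ) : ℂ) := by
      intro r hr
      have h2 : ∀ θ : ℝ, ((starRingEnd ℂ) (circleMap 0 r θ) ^ m *
          (‖circleMap 0 r θ‖ : ℂ) ^ (2 * k)) * g (circleMap 0 r θ) =
          (r : ℂ) ^ (2 * k) * ((starRingEnd ℂ) (circleMap 0 r θ) ^ m * g (circleMap 0 r θ)) := by
        intro θ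
        rw [norm_circleMap_zero, abs_of_pos hr.1]
        ring
      simp only [h2]
      rw [integral_const_mul, integral_circle_conj_pow_mul hg hp hr.1 hr.2]
      push_cast
      ring
    rw [setIntegral_congr_fun measurableSet_Ioo h1, integral_const_mul, integral_complex_ofReal,
      ← integral_Ioc_eq_integral_Ioo, ← intervalIntegral.integral_of_le zero_le_one, integral_pow]
    have hpi : (Real.pi : ℂ) ≠ 0 := by exact_mod_cast Real.pi_ne_zero
    have h3 : ((m : ℂ) + k + 1) ≠ 0 := by exact_mod_cast (by positivity : (m + k + 1 : ℝ) ≠ 0)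
    have h4 : (2 * ((m : ℂ) + k) + 1 + 1) ≠ 0 := by
      have : (2 * ((m : ℂ) + k) + 1 + 1) = 2 * (m + k + 1) := by ring
      rw [this]
      exact mul_ne_zero two_ne_zero h3
    push_cast
    simp only [one_pow, ne_eq, Nat.add_eq_zero_iff, one_ne_zero, and_false, not_false_eq_true,
      zero_pow, sub_zero]
    field_simp
    ring
  · exact ContinuousOn.mul (by fun_prop) hg.continuousOn

theorem memLp_monomial (n : ℕ) :
    MemLp (fun z : ℂ => ((√((n : ℝ) + 1) : ℝ) : ℂ) * z ^ n) 2 diskMeasure := by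
  refine MemLp.of_bound (Continuous.aestronglyMeasurable (by fun_prop)) (√((n : ℝ) + 1)) ?_
  filter_upwards [ae_mem_ball] with z hz
  have hz1 : ‖z‖ ≤ 1 := by simpa using (mem_ball_zero_iff.1 hz).le
  rw [norm_mul, norm_pow, Complex.norm_real, Real.norm_of_nonneg (by positivity)]
  exact mul_le_of_le_one_right (by positivity) (pow_le_one₀ (norm_nonneg _) hz1)

/-- The normalised monomial `√(n+1) z^n` as an element of the Bergman space. -/
noncomputable def monomial (n : ℕ) : space :=
  ⟨(memLp_monomial n).toLp fun z : ℂ => ((√((n : ℝ) + 1) : ℝ) : ℂ) * z ^ n, _,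
    (by fun_prop : Differentiable ℂ fun z : ℂ => ((√((n : ℝ) + 1) : ℝ) : ℂ) * z ^ n).differentiableOn,
    MemLp.coeFn_toLp (memLp_monomial n)⟩

theorem coeFn_monomial (n : ℕ) : (((monomial n : space) : Lp ℂ 2 diskMeasure) : ℂ → ℂ)
    =ᵐ[diskMeasure] fun z => ((√((n : ℝ) + 1) : ℝ) : ℂ) * z ^ n :=
  MemLp.coeFn_toLp (memLp_monomial n)

theorem inner_monomial_eq_integral (m : ℕ) (f : Lp ℂ 2 diskMeasure) {g : ℂ → ℂ}
    (hfg : f =ᵐ[diskMeasure] g) :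
    ⟪(monomial m : Lp ℂ 2 diskMeasure), f⟫_ℂ =
      ((√((m : ℝ) + 1) : ℝ) : ℂ) * ∫ z, (starRingEnd ℂ) z ^ m * g z ∂diskMeasure := by
  rw [L2.inner_def, ← integral_const_mul]
  refine integral_congr_ae ?_
  filter_upwards [hfg, coeFn_monomial m] with z h1 h2
  rw [RCLike.inner_apply, h1, h2, map_mul, map_pow, Complex.conj_ofReal]
  ring

theorem memLp_of_ae_eq {f : Lp ℂ 2 diskMeasure} {g : ℂ → ℂ} (hfg : f =ᵐ[diskMeasure] g) :
    MemLp g 2 diskMeasure :=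
  (memLp_congr_ae hfg).1 (Lp.memLp f)

theorem inner_monomial (m : ℕ) (f : space) {g : ℂ → ℂ}
    (hg : DifferentiableOn ℂ g (Metric.ball 0 1))
    (hfg : (f : Lp ℂ 2 diskMeasure) =ᵐ[diskMeasure] g) {p : ℕ → ℂ}
    (hp : ∀ z ∈ Metric.ball (0 : ℂ) 1, HasSum (fun n => p n * z ^ n) (g z)) :
    ⟪monomial m, f⟫_ℂ = ((√((m : ℝ) + 1) : ℝ) : ℂ) * (p m / (m + 1)) := by
  rw [Submodule.coe_inner, inner_monomial_eq_integral m f hfg]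
  have := integral_weight_mul hg (memLp_of_ae_eq hfg) hp m 0
  simp only [mul_zero, pow_zero, mul_one, Nat.cast_zero, add_zero] at this
  rw [this]

theorem orthonormal_monomial : Orthonormal ℂ monomial := by
  classical
  rw [orthonormal_iff_ite]
  intro m n
  rw [inner_monomial m (monomial n) ((by fun_prop : Differentiable ℂ
    fun z : ℂ => ((√((n : ℝ) + 1) : ℝ) : ℂ) * z ^ n).differentiableOn) (coeFn_monomial n)
    (p := Pi.single n ((√((n : ℝ) + 1) : ℝ) : ℂ)) ?_]
  · split_ifs with h
    · subst h
      have h1 : ((√((m : ℝ) + 1) : ℝ) : ℂ) * ((√((m : ℝ) + 1) : ℝ) : ℂ) = m + 1 := by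
        rw [← Complex.ofReal_mul, Real.mul_self_sqrt (by positivity)]
        push_cast
        rfl
      have h2 : ((m : ℂ) + 1) ≠ 0 := Nat.cast_add_one_ne_zero m
      rw [Pi.single_eq_same, ← mul_div_assoc, h1, div_self h2]
    · rw [Pi.single_eq_of_ne h]
      simp
  · intro z _
    convert! hasSum_single (f := fun k => (Pi.single n ((√((n : ℝ) + 1) : ℝ) : ℂ) : ℕ → ℂ) k * z ^ k)
      n (fun k hk => ?_) using 1
    · simp
    · simp [Pi.single_eq_of_ne hk]

/-- Each inner product is a nonzero multiple of one Taylor coefficient, so all of them vanish. -/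
theorem eq_zero_of_inner_monomial {f : space} (h : ∀ n, ⟪monomial n, f⟫_ℂ = 0) : f = 0 := by
  obtain ⟨g, hg, hfg⟩ := f.2
  have hp := fun z hz => hasSum_taylor hg (z := z) hz
  have hp0 : ∀ n : ℕ, (n.factorial : ℂ)⁻¹ * iteratedDeriv n g 0 = 0 := by
    intro n
    have h1 := (inner_monomial n f hg hfg hp).symm.trans (h n)
    have h2 : ((n : ℂ) + 1) ≠ 0 := Nat.cast_add_one_ne_zero n
    have h3 : ((√((n : ℝ) + 1) : ℝ) : ℂ) ≠ 0 := by
      exact_mod_cast (Real.sqrt_pos.2 (by positivity)).ne'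
    exact (div_eq_zero_iff.1 ((mul_eq_zero.1 h1).resolve_left h3)).resolve_right h2
  have hg0 : ∀ z ∈ Metric.ball (0 : ℂ) 1, g z = 0 := by
    intro z hz
    refine (hp z hz).unique ?_
    simpa only [hp0, zero_mul] using hasSum_zero
  refine Subtype.ext (Lp.ext ?_)
  filter_upwards [hfg, ae_mem_ball, Lp.coeFn_zero ℂ 2 diskMeasure] with z h1 h2 h3
  rw [h1, hg0 z h2, ZeroMemClass.coe_zero, h3, Pi.zero_apply]

/-- The orthonormal basis `√(n+1) z^n` of the Bergman space. -/
noncomputable def basis : HilbertBasis ℕ ℂ space :=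
  HilbertBasis.mkOfOrthogonalEqBot orthonormal_monomial (by
    rw [eq_bot_iff]
    intro f hf
    rw [Submodule.mem_orthogonal] at hf
    exact eq_zero_of_inner_monomial fun n => hf _ (Submodule.subset_span ⟨n, rfl⟩))

theorem basis_apply (n : ℕ) : basis n = monomial n := by
  rw [basis, HilbertBasis.coe_mkOfOrthogonalEqBot]

/-- The projection drops out because `basis m` lies in the Bergman space; what remains is the
difference of the moments for `k = 0` and `k = 1`. -/
theorem inner_basis_X (m : ℕ) (f : space) :
    ⟪basis m, X f⟫_ℂ = (1 / ((m : ℂ) + 2)) * ⟪basis m, f⟫_ℂ := by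
  obtain ⟨g, hg, hfg⟩ := f.2
  have hp := fun z hz => hasSum_taylor hg (z := z) hz
  have hL := memLp_of_ae_eq hfg
  have hX : X f = space.orthogonalProjectionOnto
      ((ContinuousLinearMap.mul ℂ ℂ).holder 2 (memLp_symbol.toLp symbol)
        (f : Lp ℂ 2 diskMeasure)) := rfl
  have hae : ((ContinuousLinearMap.mul ℂ ℂ).holder 2 (memLp_symbol.toLp symbol)
      (f : Lp ℂ 2 diskMeasure) : Lp ℂ 2 diskMeasure) =ᵐ[diskMeasure] fun z => symbol z * g z := by
    filter_upwards [(ContinuousLinearMap.mul ℂ ℂ).coeFn_holder (r := 2)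
      (memLp_symbol.toLp symbol) (f : Lp ℂ 2 diskMeasure), memLp_symbol.coeFn_toLp, hfg]
      with z h1 h2 h3
    rw [h1, h2, h3, ContinuousLinearMap.mul_apply']
  rw [basis_apply, inner_monomial m f hg hfg hp, hX,
    Submodule.inner_orthogonalProjectionOnto_eq_of_mem_left, inner_monomial_eq_integral m _ hae]
  have h0 := integral_weight_mul hg hL hp m 0
  have h1 := integral_weight_mul hg hL hp m 1
  have hsplit : ∀ z, (starRingEnd ℂ) z ^ m * (symbol z * g z) =
      ((starRingEnd ℂ) z ^ m * (‖z‖ : ℂ) ^ (2 * 0)) * g z -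
        ((starRingEnd ℂ) z ^ m * (‖z‖ : ℂ) ^ (2 * 1)) * g z := by
    intro z
    simp only [symbol]
    ring
  simp only [hsplit]
  rw [integral_sub (integrable_weight_mul hL m 0) (integrable_weight_mul hL m 1), h0, h1]
  have h2 : ((m : ℂ) + 1) ≠ 0 := Nat.cast_add_one_ne_zero m
  have h3 : ((m : ℂ) + 2) ≠ 0 := by exact_mod_cast (by positivity : (m + 2 : ℝ) ≠ 0)
  have h4 : ((m : ℂ) + 1 + 1) ≠ 0 := by
    have : (m : ℂ) + 1 + 1 = m + 2 := by ring
    rwa [this]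
  push_cast
  simp only [add_zero]
  have h5 : (m : ℂ) + 1 + 1 = m + 2 := by ring
  rw [h5]
  field_simp
  ring

theorem X_basis (n : ℕ) : X (basis n) = (1 / ((n : ℂ) + 2)) • basis n := by
  classical
  refine basis.ext_inner fun m => ?_
  rw [inner_basis_X, 
    inner_smul_right (basis m) (basis n) (1 / ((n : ℂ) + 2)),
    orthonormal_iff_ite.1 basis.orthonormal m n]
  split_ifs with h
  · rw [h]
  · simp

end Bergman

/-! ### The modular of an Orlicz function along a sequence. -/

namespace IsOrliczFunction

variable {φ : ℝ≥0 → ℝ≥0∞}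

theorem lt_top_of_tsum (hφ : IsOrliczFunction φ)
    (h : ∑' n : ℕ, φ (1 / ((n : ℝ≥0) + 1)) < ∞) {t : ℝ≥0} (ht : t ≤ 1) : φ t < ∞ := by
  refine (hφ.mono ht).trans_lt ?_
  -- The term of index `0` is `φ 1`.
  have := ENNReal.lt_top_of_tsum_ne_top h.ne 0
  simpa using this

theorem tsum_shift_lt_top (hφ : IsOrliczFunction φ)
    (h : ∑' n : ℕ, φ (1 / ((n : ℝ≥0) + 1)) < ∞) : ∑' n : ℕ, φ (1 / ((n : ℝ≥0) + 2)) < ∞ := by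
  refine lt_of_le_of_lt (ENNReal.tsum_le_tsum fun n => hφ.mono ?_) h
  gcongr
  exact one_le_two

theorem continuousOn_toNNReal (hφ : IsOrliczFunction φ) {s : Set ℝ≥0} (h : ∀ t ∈ s, φ t < ∞) :
    ContinuousOn (fun t => (φ t).toNNReal) s :=
  ENNReal.continuousOn_toNNReal.comp hφ.cont.continuousOn fun t ht => (h t ht).ne

theorem le_pow_mul_of_deltaTwo {u₀ k : ℝ≥0} (h : ∀ u ≤ u₀, φ (2 * u) ≤ k * φ u) (i : ℕ) :
    ∀ u : ℝ≥0, 2 ^ i * u ≤ u₀ → φ (2 ^ i * u) ≤ (k : ℝ≥0∞) ^ i * φ u := by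
  induction i with
  | zero => intro u _; simp
  | succ i ih =>
    intro u hu
    have h1 : 2 ^ i * u ≤ 2 ^ (i + 1) * u := by
      gcongr
      · exact one_le_two
      · exact Nat.le_succ i
    rw [pow_succ' (2 : ℝ≥0), pow_succ' (k : ℝ≥0∞), mul_assoc, mul_assoc]
    exact (h _ (h1.trans hu)).trans (mul_le_mul_right (ih u (h1.trans hu)) _)

/-- Choosing `j` with `b ≤ 2 ^ j * c` and iterating `δ₂` costs a factor `k ^ j`. This is legitimate
only for small arguments, hence the restriction to a tail. -/
theorem exists_tail_lt_top (hφ : IsOrliczFunction φ) (hδ : DeltaTwoNearZero φ) {w : ℕ → ℝ≥0}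
    (hw : Tendsto w atTop (𝓝 0)) {c : ℝ≥0} (hc : 0 < c) (h : ∑' n, φ (c * w n) < ∞) (b : ℝ≥0) :
    ∃ N : ℕ, ∑' n, φ (b * w (n + N)) < ∞ := by
  obtain ⟨u₀, k, hu₀, -, hk⟩ := hδ
  obtain ⟨j, hj⟩ : ∃ j : ℕ, b / c < 2 ^ j := pow_unbounded_of_one_lt _ one_lt_two
  have hb : b ≤ 2 ^ j * c := ((div_lt_iff₀ hc).1 hj).le
  have ht : Tendsto (fun n => 2 ^ j * (c * w n)) atTop (𝓝 0) := by
    simpa using (hw.const_mul c).const_mul (2 ^ j)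
  obtain ⟨N, hN⟩ := eventually_atTop.1 (ht.eventually_le_const hu₀)
  refine ⟨N, ?_⟩
  have h1 : ∀ n, φ (b * w (n + N)) ≤ (k : ℝ≥0∞) ^ j * φ (c * w (n + N)) := by
    intro n
    refine le_trans (hφ.mono ?_) (le_pow_mul_of_deltaTwo hk j _ (hN (n + N) (by lia)))
    rw [← mul_assoc]
    gcongr
  refine (ENNReal.tsum_le_tsum h1).trans_lt ?_
  rw [ENNReal.tsum_mul_left]
  refine ENNReal.mul_lt_top (by finiteness) (lt_of_le_of_lt ?_ h)
  exact ENNReal.tsum_comp_le_tsum_of_injective (add_left_injective N) fun n => φ (c * w n)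

/-- The finite head is continuous termwise, even where `φ` is infinite. The tail is handled by
dominated convergence for counting measure, with the dominating series taken at `t + 1`. -/
theorem continuous_tsum (hφ : IsOrliczFunction φ) (hδ : DeltaTwoNearZero φ) {w : ℕ → ℝ≥0}
    (hw : Tendsto w atTop (𝓝 0)) {c : ℝ≥0} (hc : 0 < c) (h : ∑' n, φ (c * w n) < ∞) :
    Continuous fun t => ∑' n, φ (t * w n) := by
  rw [continuous_iff_continuousAt]
  intro t
  obtain ⟨N, hN⟩ := hφ.exists_tail_lt_top hδ hw hc h (t + 1)
  have hsplit : (fun t => ∑' n, φ (t * w n)) = fun t =>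
      ∑ n ∈ Finset.range N, φ (t * w n) + ∑' n, φ (t * w (n + N)) := by
    ext t
    exact (ENNReal.summable.sum_add_tsum_nat_add' ).symm
  have hcont : ∀ n, Continuous fun t => φ (t * w n) := fun n =>
    hφ.cont.comp (continuous_id.mul continuous_const)
  rw [hsplit]
  refine ContinuousAt.add (continuous_finsetSum _ fun n _ => hcont n).continuousAt ?_
  simp only [ContinuousAt, ← lintegral_count] at hN ⊢
  refine tendsto_lintegral_filter_of_dominated_convergence (fun n => φ ((t + 1) * w (n + N)))
    (Eventually.of_forall fun _ => measurable_from_nat) ?_ hN.ne ?_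
  · filter_upwards [eventually_le_nhds (show t < t + 1 by simp)] with s hs
    exact Eventually.of_forall fun n => hφ.mono (by gcongr)
  · exact Eventually.of_forall fun n => (hcont (n + N)).tendsto t

/-- The Luxemburg norm is attained when the modular is continuous. -/
theorem luxemburg_attained (hφ : IsOrliczFunction φ) {w : ℕ → ℝ≥0} (hw : 0 < w 0)
    (hc : Continuous fun t => ∑' n, φ (t * w n)) :
    ∃ c : ℝ≥0, 0 < c ∧ {a : ℝ≥0 | 0 < a ∧ ∑' n, φ (w n / a) ≤ 1} = Set.Ici c ∧
      ∑' n, φ (c⁻¹ * w n) = 1 := by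
  set F : ℝ≥0 → ℝ≥0∞ := fun t => ∑' n, φ (t * w n) with hF
  have hmono : Monotone F := fun s t hst => ENNReal.tsum_le_tsum fun n => hφ.mono (by gcongr)
  have hF0 : F 0 = 0 := by simp [hF, hφ.map_zero]
  obtain ⟨T, hT⟩ : ∃ T, 1 < F T := by
    obtain ⟨s, hs⟩ := (hφ.tendsto_top.eventually (lt_mem_nhds ENNReal.one_lt_top)).exists
    refine ⟨s / w 0, hs.trans_le ?_⟩
    have := ENNReal.le_tsum (f := fun n => φ (s / w 0 * w n)) 0
    rwa [div_mul_cancel₀ _ hw.ne'] at this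
  obtain ⟨t₁, ht₁⟩ : (1 : ℝ≥0∞) ∈ Set.range F :=
    mem_range_of_exists_le_of_exists_ge hc ⟨0, by simp [hF0]⟩ ⟨T, hT.le⟩
  have hbdd : BddAbove {t | F t = 1} := ⟨T, fun t ht => by
    by_contra! hlt
    exact (hT.trans_le (hmono hlt.le)).ne' ht⟩
  have hcl : IsClosed {t | F t = 1} := isClosed_eq hc continuous_const
  -- The largest solution is taken because strict monotonicity of `F` is not available; it makes `{F
  -- ≤ 1}` equal to the interval up to `m`, so the Luxemburg infimum is `m⁻¹`.
  set m := sSup {t | F t = 1} with hm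
  have hm1 : F m = 1 := hcl.csSup_mem ⟨t₁, ht₁⟩ hbdd
  have hm0 : 0 < m := by
    rw [pos_iff_ne_zero]
    intro h0
    rw [h0, hF0] at hm1
    exact zero_ne_one hm1
  have hle : ∀ t, F t ≤ 1 ↔ t ≤ m := by
    intro t
    refine ⟨fun h => ?_, fun h => (hmono h).trans hm1.le⟩
    by_contra! hlt
    exact absurd (le_csSup hbdd (h.antisymm (hm1.symm.le.trans (hmono hlt.le)))) hlt.not_ge
  refine ⟨m⁻¹, inv_pos.2 hm0, ?_, by rwa [inv_inv]⟩
  ext a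
  have hFa : ∑' n, φ (w n / a) = F a⁻¹ := by
    simp only [hF, div_eq_mul_inv, mul_comm]
  simp only [Set.mem_ofPred_eq, Set.mem_Ici, hFa, hle]
  constructor
  · rintro ⟨ha, h⟩
    exact inv_le_of_inv_le₀ ha h
  · intro h
    have ha : 0 < a := (inv_pos.2 hm0).trans_le h
    exact ⟨ha, inv_le_of_inv_le₀ hm0 h⟩

end IsOrliczFunction

/-! ### Power functions, the sequence `1/(n+2)` and the zeta function. -/

theorem isOrliczFunction_sq : IsOrliczFunction fun t : ℝ≥0 => (t : ℝ≥0∞) ^ 2 where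
  convex := by
    have h := (convexOn_pow 2 : ConvexOn ℝ (Set.Ici 0) fun x : ℝ => x ^ 2)
    refine ⟨convex_univ, fun x _ y _ a b _ _ hab => ?_⟩
    have := h.2 (Set.mem_Ici.2 x.2) (Set.mem_Ici.2 y.2) a.2 b.2
      (by simpa using congrArg NNReal.toReal hab)
    simp only [ENNReal.smul_def, smul_eq_mul] at this ⊢
    exact_mod_cast this
  mono := fun s t hst => by
    have : (s : ℝ≥0∞) ≤ t := by exact_mod_cast hst
    exact pow_le_pow_left' this 2
  cont := (ENNReal.continuous_pow 2).comp ENNReal.continuous_coe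
  map_zero := by simp
  pos := fun t ht => by positivity
  tendsto_top := by
    have : Tendsto (fun t : ℝ≥0 => t ^ 2) atTop atTop := tendsto_pow_atTop two_ne_zero
    simpa using (ENNReal.tendsto_coe_nhds_top.2 this)

theorem setOf_tsum_rpow_le_one {p : ℝ} (hp : 0 < p) {w : ℕ → ℝ≥0}
    (hw : Summable fun n => w n ^ p) (hw0 : 0 < w 0) :
    {a : ℝ≥0 | 0 < a ∧ ∑' n, ((w n / a : ℝ≥0) : ℝ≥0∞) ^ p ≤ 1} =
      Set.Ici ((∑' n, w n ^ p) ^ (1 / p)) := by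
  have hZ : 0 < ∑' n, w n ^ p := (NNReal.rpow_pos hw0).trans_le (hw.le_tsum 0 fun _ _ => zero_le)
  have key : ∀ a : ℝ≥0, 0 < a →
      (∑' n, ((w n / a : ℝ≥0) : ℝ≥0∞) ^ p ≤ 1 ↔ (∑' n, w n ^ p) ^ (1 / p) ≤ a) := by
    intro a ha
    have h1 : ∑' n, ((w n / a : ℝ≥0) : ℝ≥0∞) ^ p = (((∑' n, w n ^ p) / a ^ p : ℝ≥0) : ℝ≥0∞) := by
      simp only [← ENNReal.coe_rpow_of_nonneg _ hp.le, NNReal.div_rpow]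
      rw [← ENNReal.coe_tsum (hw.div_const _), tsum_div_const]
    rw [h1, one_div, NNReal.rpow_inv_le_iff hp, ← ENNReal.coe_one, ENNReal.coe_le_coe,
      div_le_one₀ (NNReal.rpow_pos ha)]
  ext a
  simp only [Set.mem_ofPred_eq, Set.mem_Ici]
  constructor
  · rintro ⟨ha, h⟩
    exact (key a ha).1 h
  · intro h
    have ha : 0 < a := (NNReal.rpow_pos hZ).trans_le h
    exact ⟨ha, (key a ha).2 h⟩

theorem tendsto_one_div_add_two : Tendsto (fun n : ℕ => 1 / ((n : ℝ≥0) + 2)) atTop (𝓝 0) := by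
  refine NNReal.tendsto_coe.1 ?_
  have := (tendsto_add_atTop_iff_nat 1).2 (tendsto_one_div_add_atTop_nhds_zero_nat (𝕜 := ℝ))
  refine this.congr fun n => ?_
  push_cast
  ring

theorem summable_one_div_add_two_rpow {p : ℝ} (hp : 1 < p) :
    Summable fun n : ℕ => 1 / ((n : ℝ) + 2) ^ p := by
  have := (summable_nat_add_iff 2).2 (Real.summable_one_div_nat_rpow.2 hp)
  simpa using this

theorem not_summable_one_div_add_two : ¬ Summable fun n : ℕ => 1 / ((n : ℝ) + 2) := by
  intro h
  refine Real.not_summable_one_div_natCast ((summable_nat_add_iff 2).1 ?_)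
  simpa using h

theorem riemannZeta_sub_one {p : ℝ} (hp : 1 < p) :
    riemannZeta (p : ℂ) - 1 = ((∑' n : ℕ, 1 / ((n : ℝ) + 2) ^ p : ℝ) : ℂ) := by
  have hs : Summable fun n : ℕ => 1 / ((n : ℝ) + 1) ^ p := by
    have := (summable_nat_add_iff 1).2 (Real.summable_one_div_nat_rpow.2 hp)
    simpa using this
  have h1 : riemannZeta (p : ℂ) = ((∑' n : ℕ, 1 / ((n : ℝ) + 1) ^ p : ℝ) : ℂ) := by
    rw [zeta_eq_tsum_one_div_nat_add_one_cpow (by simpa using hp), Complex.ofReal_tsum]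
    congr 1 with n
    rw [Complex.ofReal_div, Complex.ofReal_cpow (by positivity)]
    norm_cast
  rw [h1, hs.tsum_eq_zero_add]
  have h2 : ∀ n : ℕ, ((n + 1 : ℕ) : ℝ) + 1 = n + 2 := fun n => by push_cast; ring
  simp only [h2]
  simp

/-! ### The general results applied to `X`. -/

namespace Bergman

theorem X_basis_nnreal (n : ℕ) :
    X (basis n) = (((1 / ((n : ℝ≥0) + 2) : ℝ≥0) : ℝ) : ℂ) • basis n := by
  rw [X_basis]
  congr 1
  push_cast
  rfl

theorem singularValue_X (n : ℕ) : HilbertOp.singularValue X n = 1 / ((n : ℝ≥0) + 2) := by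
  refine HilbertOp.singularValue_diagonal (s := fun n : ℕ => 1 / ((n : ℝ≥0) + 2)) ?_
    X_basis_nnreal n
  intro m n h
  dsimp only
  gcongr

theorem isPositive_X : X.IsPositive :=
  HilbertBasis.isPositive_diagonal X_basis_nnreal fun _ => NNReal.coe_nonneg _

theorem nonneg_X : 0 ≤ X :=
  (ContinuousLinearMap.nonneg_iff_isPositive X).2 isPositive_X

theorem tendsto_eigenvalue : Tendsto (fun n : ℕ => 1 / ((n : ℂ) + 2)) cofinite (𝓝 0) := by
  rw [Nat.cofinite_eq_atTop]
  have := (Complex.continuous_ofReal.tendsto 0).comp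
    ((NNReal.continuous_coe.tendsto 0).comp tendsto_one_div_add_two)
  simp only [Complex.ofReal_zero] at this
  refine this.congr fun n => ?_
  simp

theorem isCompactOperator_X : IsCompactOperator X :=
  HilbertBasis.isCompactOperator_diagonal X_basis tendsto_eigenvalue

theorem norm_X_le : ‖X‖ ≤ 1 := by
  refine HilbertBasis.norm_diagonal_le X_basis_nnreal zero_le_one fun n => ?_
  rw [Complex.norm_real, Real.norm_of_nonneg (NNReal.coe_nonneg _)]
  have : 1 / ((n : ℝ≥0) + 2) ≤ 1 :=
    (div_le_one₀ (by positivity)).2 (one_le_two.trans (le_add_of_nonneg_left zero_le))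
  exact_mod_cast this

/-- Since `‖X‖ ≤ 1` and `φ 1 < ∞`, `φ` is finite on the spectrum, where `toNNReal` therefore
preserves continuity. -/
theorem apply_X_basis {φ : ℝ≥0 → ℝ≥0∞} (hφ : IsOrliczFunction φ)
    (h : ∑' n : ℕ, φ (1 / ((n : ℝ≥0) + 1)) < ∞) (n : ℕ) :
    HilbertOp.apply φ X (basis n) =
      (((φ (1 / ((n : ℝ≥0) + 2))).toReal : ℝ) : ℂ) • basis n := by
  refine HilbertOp.cfc_nnreal_apply_of_eigenvector nonneg_X (X_basis_nnreal n)
    (hφ.continuousOn_toNNReal fun t ht => hφ.lt_top_of_tsum h ?_)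
  exact_mod_cast (HilbertOp.le_norm_of_mem_spectrum_nnreal ht).trans norm_X_le

theorem summable_singularValue_rpow {p : ℝ} (hp : 1 < p) :
    Summable fun n => HilbertOp.singularValue X n ^ p := by
  rw [← NNReal.summable_coe]
  refine (summable_one_div_add_two_rpow hp).congr fun n => ?_
  rw [singularValue_X, NNReal.coe_rpow]
  push_cast
  rw [Real.div_rpow zero_le_one (by positivity), Real.one_rpow]

theorem schattenNorm_X (p : ℝ) :
    HilbertOp.schattenNorm p X = (∑' n : ℕ, 1 / ((n : ℝ) + 2) ^ p) ^ (1 / p) := by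
  rw [HilbertOp.schattenNorm]
  congr 2 with n
  rw [singularValue_X]
  push_cast
  rw [Real.div_rpow zero_le_one (by positivity), Real.one_rpow]

theorem luxemburgNorm_rpow_X {p : ℝ} (hp : 1 < p) :
    (HilbertOp.luxemburgNorm (fun t : ℝ≥0 => (t : ℝ≥0∞) ^ p) X : ℝ) =
      HilbertOp.schattenNorm p X := by
  rw [HilbertOp.luxemburgNorm, setOf_tsum_rpow_le_one (by linarith)
    (summable_singularValue_rpow hp) (by rw [singularValue_X]; positivity), csInf_Ici,
    HilbertOp.schattenNorm, NNReal.coe_rpow, NNReal.coe_tsum]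
  rfl

theorem luxemburgNorm_X_attained {φ : ℝ≥0 → ℝ≥0∞} (hφ : IsOrliczFunction φ)
    (hδ : DeltaTwoNearZero φ) (hX : X ∈ HilbertOp.orliczClass φ) :
    0 < HilbertOp.luxemburgNorm φ X ∧
      ∑' n : ℕ, φ (1 / (((n : ℝ≥0) + 2) * HilbertOp.luxemburgNorm φ X)) = 1 := by
  obtain ⟨-, c, hc, hsum⟩ := hX
  have hw : Tendsto (HilbertOp.singularValue X) atTop (𝓝 0) := by
    simpa only [funext singularValue_X] using tendsto_one_div_add_two
  obtain ⟨L, hL, hset, hF⟩ := hφ.luxemburg_attained (by rw [singularValue_X]; positivity)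
    (hφ.continuous_tsum hδ hw hc hsum)
  rw [HilbertOp.luxemburgNorm, hset, csInf_Ici]
  refine ⟨hL, ?_⟩
  rw [← hF]
  congr 1 with n
  rw [singularValue_X, one_div, one_div, mul_inv, mul_comm]

end Bergman

theorem mainTheorem10 :
    ∃ e : HilbertBasis ℕ ℂ Bergman.space,
      -- the orthonormal basis `e_n(z) = √(n+1) z^n`
      (∀ n : ℕ, (((e n : Bergman.space) : Lp ℂ 2 Bergman.diskMeasure) : ℂ → ℂ)
        =ᵐ[Bergman.diskMeasure] fun z => ((√((n : ℝ) + 1) : ℝ) : ℂ) * z ^ n) ∧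
      -- spectral decomposition
      IsCompactOperator Bergman.X ∧ IsSelfAdjoint Bergman.X ∧ 0 ≤ Bergman.X ∧
      (∀ n : ℕ, Bergman.X (e n) = (1 / ((n : ℂ) + 2)) • e n) ∧
      HasSum (fun n : ℕ => (1 / ((n : ℂ) + 2)) • InnerProductSpace.rankOne ℂ (e n) (e n))
        Bergman.X ∧
      -- membership in `S_φ`
      (∃ φ : ℝ≥0 → ℝ≥0∞, IsOrliczFunction φ ∧ ∑' n : ℕ, φ (1 / ((n : ℝ≥0) + 1)) < ∞) ∧
      (∀ φ : ℝ≥0 → ℝ≥0∞, IsOrliczFunction φ → ∑' n : ℕ, φ (1 / ((n : ℝ≥0) + 1)) < ∞ →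
        HasSum (fun n : ℕ => (((φ (1 / ((n : ℝ≥0) + 2))).toReal : ℝ) : ℂ) •
          InnerProductSpace.rankOne ℂ (e n) (e n)) (HilbertOp.apply φ Bergman.X) ∧
        ∑' n : ℕ, φ (1 / ((n : ℝ≥0) + 2)) < ∞ ∧
        ∑' n : ℕ, φ (HilbertOp.singularValue Bergman.X n) =
          ∑' n : ℕ, φ (1 / ((n : ℝ≥0) + 2)) ∧
        HilbertOp.HasTrace (HilbertOp.apply φ Bergman.X)
          (((∑' n : ℕ, φ (1 / ((n : ℝ≥0) + 2))).toReal : ℝ) : ℂ) ∧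
        Bergman.X ∈ HilbertOp.orliczClass φ) ∧
      -- Schatten classes
      Bergman.X ∉ HilbertOp.schattenClass 1 ∧
      (∀ p : ℝ, 1 < p → Bergman.X ∈ HilbertOp.schattenClass p) ∧
      -- the Luxemburg norm under `δ₂` near zero
      (∀ φ : ℝ≥0 → ℝ≥0∞, IsOrliczFunction φ → DeltaTwoNearZero φ →
        Bergman.X ∈ HilbertOp.orliczClass φ →
        0 < HilbertOp.luxemburgNorm φ Bergman.X ∧
        ∑' n : ℕ, φ (1 / (((n : ℝ≥0) + 2) * HilbertOp.luxemburgNorm φ Bergman.X)) = 1) ∧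
      -- the Schatten norm, which is the Luxemburg norm for `φ(t) = t^p`
      (∀ p : ℝ, 1 < p →
        Bergman.X ∈ HilbertOp.orliczClass (fun t : ℝ≥0 => (t : ℝ≥0∞) ^ p) ∧
        (HilbertOp.luxemburgNorm (fun t : ℝ≥0 => (t : ℝ≥0∞) ^ p) Bergman.X : ℝ) =
          HilbertOp.schattenNorm p Bergman.X ∧
        HilbertOp.schattenNorm p Bergman.X =
          (∑' n : ℕ, 1 / ((n : ℝ) + 2) ^ p) ^ (1 / p) ∧
        ((HilbertOp.schattenNorm p Bergman.X : ℝ) : ℂ) =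
          (riemannZeta (p : ℂ) - 1) ^ ((1 / p : ℝ) : ℂ)) := by
  refine ⟨Bergman.basis, fun n => ?_, Bergman.isCompactOperator_X,
    IsSelfAdjoint.of_nonneg Bergman.nonneg_X, Bergman.nonneg_X, Bergman.X_basis,
    HilbertBasis.hasSum_diagonal Bergman.X_basis Bergman.tendsto_eigenvalue,
    ⟨_, isOrliczFunction_sq, ?_⟩, fun φ hφ h => ?_, ?_, fun p hp => ?_,
    fun φ hφ hδ hX => Bergman.luxemburgNorm_X_attained hφ hδ hX, fun p hp => ?_⟩
  · rw [Bergman.basis_apply]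
    exact Bergman.coeFn_monomial n
  · have hs : Summable fun n : ℕ => (1 / ((n : ℝ≥0) + 1)) ^ 2 := by
      rw [← NNReal.summable_coe]
      have := (summable_nat_add_iff 1).2 (Real.summable_one_div_nat_pow.2 one_lt_two)
      simpa using this
    have := ENNReal.tsum_coe_ne_top_iff_summable.2 hs
    simpa only [ENNReal.coe_pow] using this.lt_top
  · have hsum := hφ.tsum_shift_lt_top h
    have happ := Bergman.apply_X_basis hφ h
    have hreal : HasSum (fun n : ℕ => (φ (1 / ((n : ℝ≥0) + 2))).toReal)
        (∑' n : ℕ, φ (1 / ((n : ℝ≥0) + 2))).toReal := by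
      rw [ENNReal.tsum_toReal_eq fun n => ENNReal.ne_top_of_tsum_ne_top hsum.ne n]
      exact ENNReal.hasSum_toReal hsum.ne
    refine ⟨HilbertBasis.hasSum_diagonal happ ?_, hsum, by simp only [Bergman.singularValue_X],
      HilbertBasis.hasTrace_diagonal happ (fun _ => ENNReal.toReal_nonneg) hreal,
      Bergman.isCompactOperator_X, 1, one_pos, by simpa only [Bergman.singularValue_X, one_mul]⟩
    exact (Complex.hasSum_ofReal.2 hreal).summable.tendsto_cofinite_zero
  · rintro ⟨-, h⟩
    refine not_summable_one_div_add_two (h.congr fun n => ?_)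
    rw [Bergman.singularValue_X, Real.rpow_one]
    push_cast
    rfl
  · exact ⟨Bergman.isCompactOperator_X,
      (NNReal.summable_coe.2 (Bergman.summable_singularValue_rpow hp)).congr fun n =>
        (NNReal.coe_rpow _ _).symm⟩
  · refine ⟨⟨Bergman.isCompactOperator_X, 1, one_pos, ?_⟩, Bergman.luxemburgNorm_rpow_X hp,
      Bergman.schattenNorm_X p, ?_⟩
    · have := ENNReal.tsum_coe_ne_top_iff_summable.2 (Bergman.summable_singularValue_rpow hp)
      simp only [one_mul]
      simpa only [ENNReal.coe_rpow_of_nonneg _ (zero_le_one.trans hp.le)] using this.lt_top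
    -- The complex power agrees with the real one because its base is a nonnegative real.
    · rw [riemannZeta_sub_one hp, Bergman.schattenNorm_X,
        Complex.ofReal_cpow (tsum_nonneg fun n => by positivity)]
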